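/- Let $n,p\ge 1$. Identify $\mathscr A\in\mathbb C^{m\times n\times p}$ with its block-circulant matrix $\mathrm{bcirc}(\mathscr A)\in\mathbb C^{mp\times np}$, whose $(k,l)$ block is the frontal slice of index $k-l$ modulo $p$ (slices indexed $0,\dots,p-1$). Let $*$ denote the T-product, so that $\mathrm{bcirc}(\mathscr A*\mathscr B)=\mathrm{bcirc}(\mathscr A)\,\mathrm{bcirc}(\mathscr B)$, and let $\mathscr A^{-1}$ be the inverse for this product. A tensor $\mathscr A\in\mathbb C^{n\times n\times p}$ is *sectorial* if $\langle\mathscr X,\mathscr A*\mathscr X\rangle_F\neq0$ for all $\mathscr X\in\mathbb C^{n\times1\times p}$ with $\|\mathscr X\|_F=1$. A sectorial tensor admits sectorial decompositions $\mathrm{bcirc}(\mathscr A)=\bm T^H\bm D\bm T$ with $\bm T\in\mathbb C^{np\times np}$ nonsingular and $\bm D=\mathrm{diag}(e^{i\phi_1(\mathscr A)},\dots,e^{i\phi_{np}(\mathscr A)})$, where the *canonical T-phases* are real numbers $\phi_1(\mathscr A)\ge\cdots\ge\phi_{np}(\mathscr A)$ with $\phi_1(\mathscr A)-\phi_{np}(\mathscr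 A)<\pi$, normalized by $\tfrac12(\phi_1(\mathscr A)+\phi_{np}(\mathscr A))\in(-\pi,\pi]$; they are determined by $\mathscr A$. Write $\phi(\mathscr A)=(\phi_1(\mathscr A),\dots,\phi_{np}(\mathscr A))$ and $\mathrm{rank}_{Tp}(\mathscr A)=|\{k:\phi_k(\mathscr A)\ne0\}|$, and write $\mathscr A\in\mathcal C[0,\pi)$ if $\mathscr A$ is sectorial and $[\phi_{np}(\mathscr A),\phi_1(\mathscr A)]\subseteq[0,\pi)$. For $0\le r\le np$ put $\bm D_{r/2}(\mathscr A)=\mathrm{diag}(e^{i\phi_1(\mathscr A)/2},\dots,e^{i\phi_r(\mathscr A)/2},1,\dots,1)$, and let $\mathcal S_{Tp}(\mathscr A,r)$ be the set of tensors $\mathscr E\in\mathbb C^{n\times n\times p}$ for which there is a sectorial decomposition $\mathrm{bcirc}(\mathscr A)=\bm T^H\bm D\bm T$ with ordered canonical phases such that $\mathrm{bcirc}(\mathscr E)=\bm T^H\bm D_{r/2}(\mathscr A)\bm T$. **Theorem.** Let $\Psi:\mathbb R^{np}\to\mathbb R$ be a symmetric gauge function (a norm that is invariant under signed permutations of the coordinates),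 let $\mathscr A\in\mathcal C[0,\pi)$ and let $0\le r\le np$. Then $\mathcal S_{Tp}(\mathscr A,r)$ is nonempty. Every $\widehat{\mathscr E}\in\mathcal S_{Tp}(\mathscr A,r)$ is sectorial and satisfies $\mathrm{rank}_{Tp}(\widehat{\mathscr E})\le r$, $\widehat{\mathscr E}^{-1}*\mathscr A*\widehat{\mathscr E}^{-1}\in\mathcal C[0,\pi)$ and $$\Psi\bigl(\phi(\widehat{\mathscr E}^{-1}*\mathscr A*\widehat{\mathscr E}^{-1})\bigr)=\Psi\bigl(\phi_{r+1}(\mathscr A),\dots,\phi_{np}(\mathscr A),0,\dots,0\bigr).$$ Consequently, $$\min_{\mathscr E}\Bigl\{\Psi\bigl(\phi(\mathscr E^{-1}*\mathscr A*\mathscr E^{-1})\bigr)\;\Big|\;\mathscr E\in\mathbb C^{n\times n\times p}\text{ sectorial},\ \mathrm{rank}_{Tp}(\mathscr E)\le r,\ \mathscr E^{-1}*\mathscr A*\mathscr E^{-1}\in\mathcal C[0,\pi)\Bigr\}=\Psi\bigl(\phi_{r+1}(\mathscr A),\dots,\phi_{np}(\mathscr A),0,\dots,0\bigr),$$ and the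 minimum is attained. -/

import Mathlib

noncomputable section

namespace TPhase

/-- Third-order tensors in `ℂ^{m × n × p}`, given by their `p` frontal slices. -/
abbrev Tensor (m n p : ℕ) : Type := Fin p → Matrix (Fin m) (Fin n) ℂ

/-- The block-circulant embedding: the block in position `(k, l)` is the frontal slice with index
`k - l` modulo `p`. The index set `Fin p × Fin n` stands for `{1, …, np}` in the usual block order. -/
def bcirc {m n p : ℕ} (A : Tensor m n p) : Matrix (Fin p × Fin m) (Fin p × Fin n) ℂ :=
  Matrix.of fun x y => A (x.1 - y.1) x.2 y.2

/-- The unfolding: the frontal slices stacked on top of each other. -/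
def unfold {m n p : ℕ} (A : Tensor m n p) : Matrix (Fin p × Fin m) (Fin n) ℂ :=
  Matrix.of fun x j => A x.1 x.2 j

/-- The inverse of the unfolding. -/
def fold {m n p : ℕ} (M : Matrix (Fin p × Fin m) (Fin n) ℂ) : Tensor m n p :=
  fun k => Matrix.of fun i j => M (k, i) j

/-- The T-product. -/
def tMul {m n s p : ℕ} (A : Tensor m n p) (B : Tensor n s p) : Tensor m s p :=
  fold (bcirc A * unfold B)

/-- The identity tensor: the first frontal slice is the identity, the others vanish. -/
def tOne (n p : ℕ) : Tensor n n p := fun k => if k.val = 0 then 1 else 0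

/-- `B` is a (two-sided) T-inverse of `A`. -/
def IsTInverse {n p : ℕ} (A B : Tensor n n p) : Prop :=
  tMul A B = tOne n p ∧ tMul B A = tOne n p

open Classical in
/-- The T-inverse of a T-invertible tensor (and `0` for a tensor that is not T-invertible). -/
def tInv {n p : ℕ} (A : Tensor n n p) : Tensor n n p :=
  if h : ∃ B, IsTInverse A B then h.choose else 0

/-- The Frobenius inner product, conjugate-linear in the first argument. -/
def frobInner {m n p : ℕ} (A B : Tensor m n p) : ℂ :=
  ∑ k, ∑ i, ∑ j, star (A k i j) * B k i j

/-- The Frobenius norm. -/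
def frobNorm {m n p : ℕ} (A : Tensor m n p) : ℝ := Real.sqrt (frobInner A A).re

/-- The numerical range of a frontal-square tensor. -/
def numericalRange {n p : ℕ} (A : Tensor n n p) : Set ℂ :=
  {z | ∃ X : Tensor n 1 p, frobNorm X = 1 ∧ z = frobInner X (tMul A X)}

/-- A tensor is sectorial if `0` is not in its numerical range. -/
def Sectorial {n p : ℕ} (A : Tensor n n p) : Prop := (0 : ℂ) ∉ numericalRange A

/-- The `np × np` diagonal matrix with diagonal `d`; `finProdFinEquiv` is the enumeration of
`Fin p × Fin n` in block order. -/
def diagMat {n p : ℕ} (d : Fin (p * n) → ℂ) : Matrix (Fin p × Fin n) (Fin p × Fin n) ℂ :=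
  Matrix.diagonal fun x => d (finProdFinEquiv x)

/-- `bcirc A = Tᴴ D T` is a sectorial decomposition with `T` nonsingular and
`D = diag (e^{iφ₁}, …, e^{iφ_{np}})`. -/
def IsSectorialDecomposition {n p : ℕ} (A : Tensor n n p)
    (T : Matrix (Fin p × Fin n) (Fin p × Fin n) ℂ) (φ : Fin (p * n) → ℝ) : Prop :=
  T.det ≠ 0 ∧
    bcirc A = T.conjTranspose * diagMat (fun k => Complex.exp (Complex.I * (φ k : ℂ))) * T

section Phases

variable {n p : ℕ} [NeZero n] [NeZero p]

/-- `φ` is a canonical T-phase vector of `A`: the arguments of the diagonal unitary factor in a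
sectorial decomposition, in nonincreasing order, with spread less than `π`. The common multiple of
`2π` that is left open is fixed by placing the centre `(φ₁ + φ_{np}) / 2` in `(-π, π]`. This holds
automatically if all `φ k` lie in `(-π, π]`, and it can also be achieved when the numerical range
meets the negative real axis. -/
def IsCanonicalPhaseVector (A : Tensor n n p) (φ : Fin (p * n) → ℝ) : Prop :=
  Antitone φ ∧ φ ⊥ - φ ⊤ < Real.pi ∧ (φ ⊥ + φ ⊤) / 2 ∈ Set.Ioc (-Real.pi) Real.pi ∧
    ∃ T, IsSectorialDecomposition A T φ

open Classical in
/-- The canonical T-phase vector of a sectorial tensor (and `0` if there is none). -/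
def phase (A : Tensor n n p) : Fin (p * n) → ℝ :=
  if h : ∃ φ, IsCanonicalPhaseVector A φ then h.choose else 0

/-- `A` is sectorial and `[φ_{np}(A), φ₁(A)]` is contained in the half-open sector `[α, β)`. -/
def InSectorIco (A : Tensor n n p) (α β : ℝ) : Prop :=
  Sectorial A ∧ Set.Icc (phase A ⊤) (phase A ⊥) ⊆ Set.Ico α β

/-- The T-phase rank: the number of nonzero canonical T-phases. -/
def tpRank (A : Tensor n n p) : ℕ := (Finset.univ.filter fun k => phase A k ≠ 0).card

/-- The T-phase gauge associated with `Ψ`. -/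
def phaseGauge (Ψ : (Fin (p * n) → ℝ) → ℝ) (A : Tensor n n p) : ℝ := Ψ (phase A)

/-- The half-phase diagonal `(e^{iφ₁/2}, …, e^{iφ_r/2}, 1, …, 1)`. -/
def halfPhaseDiag (A : Tensor n n p) (r : ℕ) : Fin (p * n) → ℂ :=
  fun k => if k.val < r then Complex.exp (Complex.I * ((phase A k / 2 : ℝ) : ℂ)) else 1

/-- The set of all half-phase truncations of `A`: the tensors `E` such that
`bcirc E = Tᴴ D_{r/2} T` for some ordered sectorial decomposition `bcirc A = Tᴴ D T`. -/
def halfTruncations (A : Tensor n n p) (r : ℕ) : Set (Tensor n n p) :=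
  {E | ∃ T, IsSectorialDecomposition A T (phase A) ∧
    bcirc E = T.conjTranspose * diagMat (halfPhaseDiag A r) * T}

/-- The tensor `E⁻¹ * A * E⁻¹`. -/
def invSandwich (E A : Tensor n n p) : Tensor n n p := tMul (tMul (tInv E) A) (tInv E)

/-- The feasible set of the low T-phase-rank approximation problem. -/
def feasible (A : Tensor n n p) (r : ℕ) : Set (Tensor n n p) :=
  {E | InSectorIco (invSandwich E A) 0 Real.pi ∧ Sectorial E ∧ tpRank E ≤ r}

/-- The vector `(φ_{r+1}(A), …, φ_{np}(A), 0, …, 0)` of length `np`. -/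
def tailPhases (A : Tensor n n p) (r : ℕ) : Fin (p * n) → ℝ :=
  fun i => if h : i.val + r < p * n then phase A ⟨i.val + r, h⟩ else 0

end Phases

/-- A symmetric gauge function on `ℝ^N`: a norm that is invariant under signed permutations
of the coordinates. -/
structure IsSymmetricGauge {N : ℕ} (Ψ : (Fin N → ℝ) → ℝ) : Prop where
  nonneg : ∀ x, 0 ≤ Ψ x
  eq_zero_iff : ∀ x, Ψ x = 0 ↔ x = 0
  smul : ∀ (c : ℝ) x, Ψ (c • x) = |c| * Ψ x
  add_le : ∀ x y, Ψ (x + y) ≤ Ψ x + Ψ y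
  signed_perm : ∀ (σ : Equiv.Perm (Fin N)) (s : Fin N → ℝ), (∀ i, s i = 1 ∨ s i = -1) →
    ∀ x, Ψ (fun i => s i * x (σ i)) = Ψ x

end TPhase

end

open TPhase

/-!
The theorem concerns the form `xᴴ M x` of the matrix `M = bcirc A`, and everything is read off from
decompositions `M = Tᴴ D T` with `D` a unitary diagonal matrix.

*Existence.* By the Toeplitz–Hausdorff theorem (`convex_hForm_image`) the numerical range of a
sectorial tensor lies in an open half-plane. A matrix with this property is congruent to a unitary
diagonal one (`exists_expDiag_of_re_pos`). Applying this to each block of the discrete Fourier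
transform of `A` gives a decomposition for which all `Tᴴ D' T` with `D'` diagonal are
block-circulant (`exists_canonical`); this is why half-phase truncations exist.

*Comparison and uniqueness.* A Courant–Fischer argument (`phase_le_phase`) shows: if the form of `M`
at `x` equals that of `B` at `E x` on a subspace of codimension at most `r`, then the ordered phases
satisfy `φ_{i+r}(M) ≤ φ_i(B)`. With `r = 0` and `E = 1` this makes the canonical phases unique
(`IsCanonicalPhaseVector.unique`), so the phases of a truncation `E` and of `E⁻¹ * A * E⁻¹` can be
computed from explicit decompositions (`isCanonicalPhaseVector_tailPhases`).

*Lower bound.* Let `E` be feasible with at most `r` nonzero phases and put `B = E⁻¹ * A * E⁻¹`. On a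
subspace of codimension at most `r` the matrices of `E` and its conjugate transpose agree, and there
`xᴴ A x = xᴴ E B E x = (E x)ᴴ B (E x)`. Hence `φ_{i+r}(A) ≤ φ_i(B)` for all `i`
(`tailPhases_le_phase`), and symmetric gauge functions are monotone on nonnegative vectors
(`IsSymmetricGauge.mono`).
-/

noncomputable section

namespace TPhase

open Matrix

/-! ### Quadratic forms and the Toeplitz–Hausdorff theorem -/

section Form
variable {ι : Type*} [Fintype ι]

/-- The quadratic form `xᴴ M x` of a complex matrix. -/
def hForm (M : Matrix ι ι ℂ) (x : ι → ℂ) : ℂ := star x ⬝ᵥ M *ᵥ x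

lemma hForm_smul (M : Matrix ι ι ℂ) (c : ℂ) (x : ι → ℂ) :
    hForm M (c • x) = (Complex.normSq c : ℂ) * hForm M x := by
  simp only [hForm, star_smul, mulVec_smul, smul_dotProduct, dotProduct_smul, smul_eq_mul,
    Complex.normSq_eq_conj_mul_self, starRingEnd_apply]
  ring

lemma hForm_add (M : Matrix ι ι ℂ) (x y : ι → ℂ) :
    hForm M (x + y) = hForm M x + hForm M y + star x ⬝ᵥ M *ᵥ y + star y ⬝ᵥ M *ᵥ x := by
  simp only [hForm, star_add, mulVec_add, add_dotProduct, dotProduct_add]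
  ring

lemma hForm_conjTranspose_mul_mul {κ : Type*} [Fintype κ] (T : Matrix κ ι ℂ) (M : Matrix κ κ ℂ)
    (x : ι → ℂ) : hForm (Tᴴ * M * T) x = hForm M (T *ᵥ x) := by
  simp only [hForm, star_mulVec, ← mulVec_mulVec, dotProduct_mulVec, vecMul_vecMul]

lemma hForm_diagonal [DecidableEq ι] (d : ι → ℂ) (x : ι → ℂ) :
    hForm (diagonal d) x = ∑ k, d k * (Complex.normSq (x k) : ℂ) := by
  simp only [hForm, dotProduct, mulVec_diagonal, Complex.normSq_eq_conj_mul_self,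
    starRingEnd_apply, Pi.star_apply]
  exact Finset.sum_congr rfl fun k _ => by ring

/-- For every direction `δ`, the mixed term of the form at `x` and `u y` becomes a real multiple of
`δ` for a suitable unimodular `u`. -/
lemma exists_unimodular_im_eq_zero (a b δ : ℂ) :
    ∃ u : ℂ, Complex.normSq u = 1 ∧
      ((u * a + (starRingEnd ℂ) u * b) * (starRingEnd ℂ) δ).im = 0 := by
  set m : ℂ := a * (starRingEnd ℂ) δ - (starRingEnd ℂ) b * δ with hm
  have key : ∀ u : ℂ, ((u * a + (starRingEnd ℂ) u * b) * (starRingEnd ℂ) δ).im = (u * m).im := by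
    intro u
    simp only [hm, Complex.mul_im, Complex.add_im, Complex.add_re, Complex.mul_re, Complex.conj_re,
      Complex.conj_im, Complex.sub_re, Complex.sub_im]
    ring
  by_cases h : m = 0
  · exact ⟨1, by simp, by rw [key, h]; simp⟩
  · refine ⟨(starRingEnd ℂ) m / (‖m‖ : ℂ), ?_, ?_⟩
    · have : ‖m‖ ≠ 0 := norm_ne_zero_iff.2 h
      rw [Complex.normSq_eq_norm_sq, norm_div, RCLike.norm_conj, Complex.norm_real, norm_norm,
        div_self this, one_pow]
    · rw [key, div_mul_eq_mul_div, ← Complex.normSq_eq_conj_mul_self, ← Complex.ofReal_div,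
        Complex.ofReal_im]

/-- The squared Euclidean length of a complex vector. -/
def lengthSq (x : ι → ℂ) : ℝ := ∑ k, Complex.normSq (x k)

lemma lengthSq_smul (c : ℂ) (x : ι → ℂ) :
    lengthSq (c • x) = Complex.normSq c * lengthSq x := by
  simp [lengthSq, Finset.mul_sum]

lemma lengthSq_pos {x : ι → ℂ} (hx : x ≠ 0) : 0 < lengthSq x := by
  obtain ⟨k, hk⟩ := Function.ne_iff.1 hx
  exact Finset.sum_pos' (fun _ _ => Complex.normSq_nonneg _)
    ⟨k, Finset.mem_univ _, Complex.normSq_pos.2 hk⟩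

lemma continuous_lengthSq : Continuous (lengthSq : (ι → ℂ) → ℝ) := by
  unfold lengthSq
  exact continuous_finsetSum _ fun k _ => Complex.continuous_normSq.comp (continuous_apply k)

lemma isCompact_lengthSq_eq_one : IsCompact {x : ι → ℂ | lengthSq x = 1} := by
  refine Metric.isCompact_of_isClosed_isBounded
    (isClosed_singleton.preimage continuous_lengthSq) ?_
  refine (Metric.isBounded_closedBall (x := (0 : ι → ℂ)) (r := 1)).subset fun x hx => ?_
  rw [mem_closedBall_zero_iff, pi_norm_le_iff_of_nonneg zero_le_one]
  intro k
  have h1 : Complex.normSq (x k) ≤ 1 :=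
    (Finset.single_le_sum (fun j _ => Complex.normSq_nonneg (x j)) (Finset.mem_univ k)).trans
      (le_of_eq hx)
  rw [Complex.normSq_eq_norm_sq] at h1
  exact (sq_le_one_iff₀ (norm_nonneg _)).1 h1

lemma hForm_sub_smul_one [DecidableEq ι] (M : Matrix ι ι ℂ) (a : ℂ) (x : ι → ℂ) :
    hForm (M - a • 1) x = hForm M x - a * (lengthSq x : ℂ) := by
  simp only [hForm, sub_mulVec, dotProduct_sub, smul_mulVec, one_mulVec, dotProduct_smul,
    smul_eq_mul, lengthSq, Complex.ofReal_sum, Complex.normSq_eq_conj_mul_self, starRingEnd_apply]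
  rfl

/-- The Toeplitz–Hausdorff theorem. For unit vectors `x`, `y` with form values `a` and `b`, replace
`M` by `M - a`. The points `x` and `u y`, with `u` chosen by `exists_unimodular_im_eq_zero`, are
joined by an arc on which the new form is real in units of `b - a`; the intermediate value theorem
applies to its normalization. -/
lemma convex_hForm_image (M : Matrix ι ι ℂ) :
    Convex ℝ (hForm M '' {x | lengthSq x = 1}) := by
  classical
  rintro _ ⟨x, hx, rfl⟩ _ ⟨y, hy, rfl⟩ a b ha hb hab
  simp only [Set.mem_ofPred_eq] at hx hy
  set δ : ℂ := hForm M y - hForm M x with hδ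
  by_cases hδ0 : δ = 0
  · have hxy : hForm M y = hForm M x := sub_eq_zero.1 hδ0
    exact ⟨x, hx, by rw [hxy, ← add_smul, hab, one_smul]⟩
  set M' : Matrix ι ι ℂ := M - hForm M x • 1 with hM'
  have hx' : hForm M' x = 0 := by rw [hM', hForm_sub_smul_one, hx]; simp
  have hy' : hForm M' y = δ := by rw [hM', hForm_sub_smul_one, hy]; simp [hδ]
  obtain ⟨u, hu, him⟩ := exists_unimodular_im_eq_zero
    (star x ⬝ᵥ M' *ᵥ y) (star y ⬝ᵥ M' *ᵥ x) δ
  set cr : ℂ := u * (star x ⬝ᵥ M' *ᵥ y) + (starRingEnd ℂ) u * (star y ⬝ᵥ M' *ᵥ x) with hcr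
  obtain ⟨κ, hκ⟩ : ∃ κ : ℝ, cr = κ * δ := by
    refine ⟨(cr * (starRingEnd ℂ) δ).re / Complex.normSq δ, ?_⟩
    have h1 : ((cr * (starRingEnd ℂ) δ).re : ℂ) = cr * (starRingEnd ℂ) δ := by
      apply Complex.ext <;> simp [him]
    have h2 : (starRingEnd ℂ) δ ≠ 0 := by simpa using hδ0
    rw [Complex.ofReal_div, h1, ← Complex.mul_conj]
    field_simp
  let z : ℝ → ι → ℂ := fun s => (Real.cos s : ℂ) • x + ((Real.sin s : ℂ) * u) • y
  let g : ℝ → ℝ := fun s => Real.sin s ^ 2 + κ * (Real.sin s * Real.cos s)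
  have hz : ∀ s, hForm M' (z s) = (g s : ℂ) * δ := by
    intro s
    simp only [z, g]
    rw [hForm_add, hForm_smul, hForm_smul, Complex.normSq_mul, hu, Complex.normSq_ofReal,
      Complex.normSq_ofReal, hx', hy']
    have : star ((Real.cos s : ℂ) • x) ⬝ᵥ M' *ᵥ (((Real.sin s : ℂ) * u) • y)
        + star (((Real.sin s : ℂ) * u) • y) ⬝ᵥ M' *ᵥ ((Real.cos s : ℂ) • x)
        = (Real.sin s : ℂ) * (Real.cos s : ℂ) * cr := by
      simp only [hcr, star_smul, mulVec_smul, smul_dotProduct, dotProduct_smul, smul_eq_mul,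
        star_mul', Complex.star_def, Complex.conj_ofReal]
      ring
    rw [add_assoc, this, hκ]
    push_cast
    ring
  have hzs : ∀ s, z s ≠ 0 := by
    intro s h0
    have hu0 : u ≠ 0 := by rintro rfl; simp at hu
    have hne : ∀ v : ι → ℂ, lengthSq v = 1 → v ≠ 0 := by
      rintro v hv rfl; simp [lengthSq] at hv
    by_cases hsin : (Real.sin s : ℂ) = 0
    · have hcos : (Real.cos s : ℂ) ≠ 0 := by
        intro h'
        have := Real.sin_sq_add_cos_sq s
        rw [Complex.ofReal_eq_zero.1 hsin, Complex.ofReal_eq_zero.1 h'] at this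
        norm_num at this
      simp only [z, hsin, zero_mul, zero_smul, add_zero] at h0
      exact hne x hx ((smul_eq_zero.1 h0).resolve_left hcos)
    · have h1 : y = (-((Real.sin s : ℂ) * u)⁻¹ * Real.cos s) • x := by
        have h1 : ((Real.sin s : ℂ) * u) • y = -((Real.cos s : ℂ) • x) :=
          eq_neg_of_add_eq_zero_right h0
        rw [mul_smul, neg_smul, ← smul_neg, ← h1, inv_smul_smul₀ (mul_ne_zero hsin hu0)]
      rw [h1, hForm_smul, hx', mul_zero] at hy'
      exact hδ0 hy'.symm
  have hlen : ∀ s, 0 < lengthSq (z s) := fun s => lengthSq_pos (hzs s)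
  obtain ⟨s, -, hs⟩ : ∃ s ∈ Set.Icc 0 (Real.pi / 2), g s / lengthSq (z s) = b := by
    have hcont : ContinuousOn (fun s : ℝ => g s / lengthSq (z s)) (Set.Icc 0 (Real.pi / 2)) := by
      refine Continuous.continuousOn (Continuous.div ?_ ?_ fun s => (hlen s).ne')
      · simp only [g]; fun_prop
      · exact continuous_lengthSq.comp (by simp only [z]; fun_prop)
    have := intermediate_value_Icc (by positivity) hcont
    refine this ?_
    have e : lengthSq (z (Real.pi / 2)) = 1 := by simp [z, lengthSq_smul, hu, hy]
    simp only [e, Set.mem_Icc]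
    simp only [g, Real.sin_zero, Real.cos_zero, Real.sin_pi_div_two, Real.cos_pi_div_two]
    constructor
    · simpa using hb
    · norm_num; linarith
  have hz1 : lengthSq ((((√(lengthSq (z s)))⁻¹ : ℝ) : ℂ) • z s) = 1 := by
    rw [lengthSq_smul, Complex.normSq_ofReal, ← mul_inv, Real.mul_self_sqrt (hlen s).le,
      inv_mul_cancel₀ (hlen s).ne']
  refine ⟨_, hz1, ?_⟩
  have h1 := hForm_sub_smul_one M (hForm M x) ((((√(lengthSq (z s)))⁻¹ : ℝ) : ℂ) • z s)
  rw [hz1, ← hM', hForm_smul, hz, Complex.normSq_ofReal, ← mul_inv,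
    Real.mul_self_sqrt (hlen s).le, ← mul_assoc, ← Complex.ofReal_mul, mul_comm _ (g s),
    ← div_eq_mul_inv, hs] at h1
  rw [Complex.real_smul, Complex.real_smul, ← eq_sub_iff_add_eq.2 hab |>.symm]
  rw [Complex.ofReal_one, mul_one, hδ] at h1
  rw [Complex.ofReal_sub, Complex.ofReal_one]
  linear_combination -h1

/-- A form without nontrivial zeros takes its values in an open half-plane. -/
lemma exists_rotation_re_pos (M : Matrix ι ι ℂ) (hM : ∀ x ≠ 0, hForm M x ≠ 0) :
    ∃ θ : ℝ, ∀ x ≠ 0, 0 < (Complex.exp (-(Complex.I * θ)) * hForm M x).re := by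
  have hcont : Continuous (hForm M) := by
    unfold hForm
    fun_prop
  let K : Set ℂ := hForm M '' {x | lengthSq x = 1}
  have hK : IsCompact K := isCompact_lengthSq_eq_one.image hcont
  have h0 : (0 : ℂ) ∉ K := by
    rintro ⟨x, hx, hx0⟩
    refine hM x ?_ hx0
    rintro rfl
    simp [lengthSq] at hx
  obtain ⟨f, u, hu0, hu⟩ := geometric_hahn_banach_point_closed (convex_hForm_image M)
    hK.isClosed h0
  rw [map_zero] at hu0
  set w : ℂ := ⟨f 1, f Complex.I⟩ with hw
  have hf : ∀ z : ℂ, f z = ((starRingEnd ℂ) w * z).re := by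
    intro z
    have : z = z.re • (1 : ℂ) + z.im • Complex.I := by
      apply Complex.ext <;> simp
    conv_lhs => rw [this]
    rw [map_add, map_smul, map_smul]
    simp [hw, Complex.mul_re]
    ring
  refine ⟨w.arg, fun x hx => ?_⟩
  have hn : 0 < lengthSq x := lengthSq_pos hx
  have hmem : hForm M ((((√(lengthSq x))⁻¹ : ℝ) : ℂ) • x) ∈ K := by
    refine ⟨_, ?_, rfl⟩
    rw [Set.mem_ofPred_eq, lengthSq_smul, Complex.normSq_ofReal, ← mul_inv,
      Real.mul_self_sqrt hn.le, inv_mul_cancel₀ hn.ne']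
  have h1 := hu0.trans (hu _ hmem)
  rw [hf, hForm_smul, Complex.normSq_ofReal, ← mul_assoc, mul_comm ((starRingEnd ℂ) w),
    mul_assoc, Complex.re_ofReal_mul] at h1
  have h2 : 0 < ((starRingEnd ℂ) w * hForm M x).re := pos_of_mul_pos_right h1 (mul_self_nonneg _)
  have h3 : (starRingEnd ℂ) w = (‖w‖ : ℂ) * Complex.exp (-(Complex.I * w.arg)) := by
    conv_lhs => rw [← Complex.norm_mul_exp_arg_mul_I w]
    rw [map_mul, Complex.conj_ofReal, ← Complex.exp_conj]
    simp [mul_comm]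
  rw [h3, mul_assoc, Complex.re_ofReal_mul] at h2
  exact pos_of_mul_pos_right h2 (norm_nonneg _)

end Form

/-! ### Sectorial decompositions of matrices and comparison of phases -/

section Decomposition

open scoped ComplexOrder MatrixOrder

variable {ι : Type*} [Fintype ι] [DecidableEq ι]

/-- The unitary diagonal matrix with phases `φ`. -/
def expDiag (φ : ι → ℝ) : Matrix ι ι ℂ := diagonal fun k => Complex.exp (Complex.I * (φ k : ℂ))

lemma hForm_expDiag {κ : Type*} [Fintype κ] (T : Matrix ι κ ℂ) (φ : ι → ℝ) (x : κ → ℂ) :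
    hForm (Tᴴ * expDiag φ * T) x =
      ∑ k, Complex.exp (Complex.I * (φ k : ℂ)) * (Complex.normSq ((T *ᵥ x) k) : ℂ) := by
  rw [hForm_conjTranspose_mul_mul, expDiag, hForm_diagonal]

/-- A matrix whose form takes its values in the open half-plane with inner normal `e^{iθ}` is
congruent to a unitary diagonal matrix with phases within `π / 2` of `θ`: write
`e^{-iθ} M = H + i K` with `H` and `K` Hermitian, so that `H = Rᴴ R` is positive definite, and
diagonalize the Hermitian matrix `R⁻ᴴ K R⁻¹`. -/
lemma exists_expDiag_of_re_pos (M : Matrix ι ι ℂ) (θ : ℝ)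
    (h : ∀ x ≠ 0, 0 < (Complex.exp (-(Complex.I * θ)) * hForm M x).re) :
    ∃ (T : Matrix ι ι ℂ) (φ : ι → ℝ), (∀ k, |φ k - θ| < Real.pi / 2) ∧
      M = Tᴴ * expDiag φ * T := by
  set e : ℂ := Complex.exp (-(Complex.I * θ)) with he
  set M' : Matrix ι ι ℂ := e • M with hM'
  have hMform : ∀ x, hForm M' x = e * hForm M x := by
    intro x; simp [hForm, hM', smul_mulVec, dotProduct_smul]
  have hstar : ∀ x, hForm M'ᴴ x = star (hForm M' x) := by
    intro x
    rw [hForm, hForm, star_dotProduct, star_mulVec, conjTranspose_conjTranspose,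
      ← dotProduct_mulVec]
  set H : Matrix ι ι ℂ := (1 / 2 : ℂ) • (M' + M'ᴴ) with hH
  set K : Matrix ι ι ℂ := (-Complex.I / 2) • (M' - M'ᴴ) with hK
  have hHK : M' = H + Complex.I • K := by
    rw [hH, hK, smul_smul]
    have : Complex.I * (-Complex.I / 2) = 1 / 2 := by
      rw [mul_div_assoc', mul_neg, Complex.I_mul_I, neg_neg]
    rw [this, ← smul_add]
    ext i j; simp; ring
  have hKh : K.IsHermitian := by
    ext i j
    simp [hK]
    ring
  have hHpos : H.PosDef := by
    refine PosDef.of_dotProduct_mulVec_pos ?_ fun x hx => ?_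
    · ext i j
      simp [hH]
      ring
    · have e1 : star x ⬝ᵥ H *ᵥ x = (((e * hForm M x).re : ℝ) : ℂ) := by
        change hForm H x = _
        have : hForm H x = (1 / 2 : ℂ) * (hForm M' x + hForm M'ᴴ x) := by
          simp only [hForm, hH, smul_mulVec, dotProduct_smul, add_mulVec, dotProduct_add,
            smul_eq_mul]
        rw [this, hstar, hMform, Complex.star_def, Complex.add_conj]
        push_cast; ring
      rw [e1]
      exact_mod_cast h x hx
  obtain ⟨R, hRu, hR⟩ : ∃ R : Matrix ι ι ℂ, IsUnit R ∧ H = Rᴴ * R := by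
    obtain ⟨R, hR⟩ := CStarAlgebra.nonneg_iff_eq_star_mul_self.mp hHpos.posSemidef.nonneg
    refine ⟨R, ?_, hR⟩
    have hu := hHpos.isUnit
    rw [hR] at hu
    exact isUnit_of_mul_isUnit_right hu
  have hRdet : IsUnit R.det := (isUnit_iff_isUnit_det R).1 hRu
  set C : Matrix ι ι ℂ := (R⁻¹)ᴴ * K * R⁻¹ with hC
  have hCh : C.IsHermitian := isHermitian_conjTranspose_mul_mul _ hKh
  have hKC : K = Rᴴ * C * R := by
    rw [hC]
    have h1 : Rᴴ * (R⁻¹)ᴴ = 1 := by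
      rw [← conjTranspose_mul, nonsing_inv_mul _ hRdet, conjTranspose_one]
    calc K = (Rᴴ * (R⁻¹)ᴴ) * K * (R⁻¹ * R) := by rw [h1, nonsing_inv_mul _ hRdet]; simp
      _ = _ := by simp only [Matrix.mul_assoc]
  set U : Matrix ι ι ℂ := (hCh.eigenvectorUnitary : Matrix ι ι ℂ) with hU
  have hUU : U * Uᴴ = 1 := by
    rw [← star_eq_conjTranspose]
    exact Unitary.mul_star_self_of_mem hCh.eigenvectorUnitary.2
  set l := hCh.eigenvalues with hl
  have hCU : C = U * diagonal (fun k => (l k : ℂ)) * Uᴴ := by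
    have := hCh.spectral_theorem
    rw [Unitary.conjStarAlgAut_apply] at this
    exact this
  -- The entries `1 + i l` of the diagonalized matrix, in polar form.
  set μ : ι → ℂ := fun k => 1 + Complex.I * (l k : ℂ) with hμ
  have hμre : ∀ k, 0 < (μ k).re := by intro k; simp [hμ]
  have hM'2 : M' = Rᴴ * U * diagonal μ * (Uᴴ * R) := by
    have h1 : diagonal μ = 1 + Complex.I • diagonal (fun k => (l k : ℂ)) := by
      rw [← diagonal_one, ← diagonal_smul, diagonal_add]; rfl
    rw [hHK, hKC, hR, hCU, h1]
    simp only [Matrix.mul_add, Matrix.add_mul, Matrix.mul_one, Matrix.mul_smul, Matrix.smul_mul]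
    congr 1
    · rw [Matrix.mul_assoc, ← Matrix.mul_assoc U, hUU, Matrix.one_mul]
    · simp only [Matrix.mul_assoc]
  set ρ : ι → ℂ := fun k => ((√‖μ k‖ : ℝ) : ℂ) with hρ
  refine ⟨diagonal ρ * (Uᴴ * R), fun k => θ + (μ k).arg, ?_, ?_⟩
  · intro k
    rw [add_sub_cancel_left, Complex.abs_arg_lt_pi_div_two_iff]
    exact Or.inl (hμre k)
  · have h1 : M = Complex.exp (Complex.I * θ) • M' := by
      rw [hM', smul_smul, he, ← Complex.exp_add, add_neg_cancel, Complex.exp_zero, one_smul]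
    have h2 : Complex.exp (Complex.I * θ) • diagonal μ
        = (diagonal ρ)ᴴ * expDiag (fun k => θ + (μ k).arg) * diagonal ρ := by
      rw [expDiag, diagonal_conjTranspose, diagonal_mul_diagonal, diagonal_mul_diagonal,
        ← diagonal_smul]
      congr 1
      ext k
      have h3 : star (ρ k) * ρ k = (‖μ k‖ : ℂ) := by
        rw [hρ, Complex.star_def, Complex.conj_ofReal, ← Complex.ofReal_mul,
          Real.mul_self_sqrt (norm_nonneg _)]
      have h4 : μ k = (‖μ k‖ : ℂ) * Complex.exp (Complex.I * (μ k).arg) := by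
        rw [mul_comm Complex.I, Complex.norm_mul_exp_arg_mul_I]
      simp only [Pi.smul_apply, smul_eq_mul, Pi.star_apply]
      conv_lhs => rw [h4]
      rw [Complex.ofReal_add, mul_add, Complex.exp_add]
      linear_combination (-Complex.exp (Complex.I * θ) * Complex.exp (Complex.I * (μ k).arg)) * h3
    rw [h1, hM'2, ← Matrix.smul_mul, ← Matrix.mul_smul, h2]
    simp only [conjTranspose_mul, conjTranspose_conjTranspose, Matrix.mul_assoc]

omit [DecidableEq ι] in
lemma exp_neg_mul_sum (c φ : ι → ℝ) (γ : ℝ) :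
    Complex.exp (-(Complex.I * γ)) * ∑ k, Complex.exp (Complex.I * (φ k : ℂ)) * (c k : ℂ)
      = ∑ k, Complex.exp (((φ k - γ : ℝ) : ℂ) * Complex.I) * (c k : ℂ) := by
  rw [Finset.mul_sum]
  refine Finset.sum_congr rfl fun k _ => ?_
  rw [← mul_assoc, ← Complex.exp_add]
  congr 2
  push_cast; ring

omit [DecidableEq ι] in
lemma im_exp_neg_mul_sum (c φ : ι → ℝ) (γ : ℝ) :
    (Complex.exp (-(Complex.I * γ)) * ∑ k, Complex.exp (Complex.I * (φ k : ℂ)) * (c k : ℂ)).im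
      = ∑ k, Real.sin (φ k - γ) * c k := by
  simp_rw [exp_neg_mul_sum, Complex.im_sum, Complex.im_mul_ofReal, Complex.exp_ofReal_mul_I_im]

omit [DecidableEq ι] in
lemma re_exp_neg_mul_sum (c φ : ι → ℝ) (γ : ℝ) :
    (Complex.exp (-(Complex.I * γ)) * ∑ k, Complex.exp (Complex.I * (φ k : ℂ)) * (c k : ℂ)).re
      = ∑ k, Real.cos (φ k - γ) * c k := by
  simp_rw [exp_neg_mul_sum, Complex.re_sum, Complex.re_mul_ofReal, Complex.exp_ofReal_mul_I_re]

/-- Phases in an open half-circle force the form to avoid `0`. -/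
lemma hForm_expDiag_ne_zero (T : Matrix ι ι ℂ) (hT : T.det ≠ 0) (φ : ι → ℝ) (θ : ℝ)
    (h : ∀ k, |φ k - θ| < Real.pi / 2) {x : ι → ℂ} (hx : x ≠ 0) :
    hForm (Tᴴ * expDiag φ * T) x ≠ 0 := by
  intro h0
  have hTx : T *ᵥ x ≠ 0 := fun h' => hx (eq_zero_of_mulVec_eq_zero hT h')
  obtain ⟨j, hj⟩ := Function.ne_iff.1 hTx
  have h1 : 0 < (Complex.exp (-(Complex.I * θ)) * hForm (Tᴴ * expDiag φ * T) x).re := by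
    rw [hForm_expDiag, re_exp_neg_mul_sum]
    have hcos : ∀ k, 0 < Real.cos (φ k - θ) := fun k =>
      Real.cos_pos_of_mem_Ioo ⟨(abs_lt.1 (h k)).1, (abs_lt.1 (h k)).2⟩
    exact Finset.sum_pos' (fun k _ => mul_nonneg (hcos k).le (Complex.normSq_nonneg _))
      ⟨j, Finset.mem_univ _, mul_pos (hcos j) (Complex.normSq_pos.2 hj)⟩
  rw [h0] at h1
  simp at h1

omit [DecidableEq ι] in
/-- If one complex number is a nonnegative combination of the `e^{iφ_k}` with `φ_k ∈ [α, a]` and a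
nontrivial nonnegative combination of the `e^{iψ_k}` with `ψ_k ∈ [b, β]`, then `α ≤ β`. Otherwise a
line through `0` in a direction strictly between `β` and `α` separates the two sectors; the bound
`a - b < 2π` is what allows the direction to be chosen such that it does. -/
lemma le_of_sum_exp_eq (c d φ ψ : ι → ℝ) (hc : ∀ k, 0 ≤ c k) (hd : ∀ k, 0 ≤ d k)
    {α β a b : ℝ} (haα : a - α < Real.pi) (hβb : β - b < Real.pi) (hab : a - b < 2 * Real.pi)
    (hφ : ∀ k, c k ≠ 0 → α ≤ φ k ∧ φ k ≤ a) (hψ : ∀ k, d k ≠ 0 → b ≤ ψ k ∧ ψ k ≤ β)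
    (hne : ∃ k, d k ≠ 0)
    (h : ∑ k, Complex.exp (Complex.I * (φ k : ℂ)) * (c k : ℂ)
      = ∑ k, Complex.exp (Complex.I * (ψ k : ℂ)) * (d k : ℂ)) : α ≤ β := by
  by_contra! hlt
  obtain ⟨γ, hγ1, hγ2⟩ : ∃ γ, max β (a - Real.pi) < γ ∧ γ < min α (b + Real.pi) := by
    refine exists_between (max_lt (lt_min hlt ?_) (lt_min ?_ ?_)) <;> linarith
  rw [max_lt_iff] at hγ1
  rw [lt_min_iff] at hγ2
  have h1 := congrArg (fun z => (Complex.exp (-(Complex.I * γ)) * z).im) h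
  simp only [im_exp_neg_mul_sum] at h1
  have h2 : 0 ≤ ∑ k, Real.sin (φ k - γ) * c k := by
    refine Finset.sum_nonneg fun k _ => ?_
    by_cases hk : c k = 0
    · simp [hk]
    · obtain ⟨h3, h4⟩ := hφ k hk
      exact mul_nonneg (Real.sin_nonneg_of_nonneg_of_le_pi (by linarith) (by linarith)) (hc k)
  have hneg : ∀ k, d k ≠ 0 → Real.sin (ψ k - γ) * d k < 0 := by
    intro k hk
    obtain ⟨h3, h4⟩ := hψ k hk
    exact mul_neg_of_neg_of_pos (Real.sin_neg_of_neg_of_neg_pi_lt (by linarith) (by linarith))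
      ((hd k).lt_of_ne' hk)
  have h3 : ∑ k, Real.sin (ψ k - γ) * d k < 0 := by
    obtain ⟨j, hj⟩ := hne
    refine Finset.sum_neg' (fun k _ => ?_) ⟨j, Finset.mem_univ _, hneg j hj⟩
    by_cases hk : d k = 0
    · simp [hk]
    · exact (hneg k hk).le
  linarith

omit [DecidableEq ι] in
/-- Fewer homogeneous linear equations than unknowns. -/
lemma exists_ne_zero_of_card_lt {κ : Type*} [Fintype κ] (f : κ → (ι → ℂ) →ₗ[ℂ] ℂ)
    (h : Fintype.card κ < Fintype.card ι) : ∃ x ≠ 0, ∀ k, f k x = 0 := by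
  have hker : LinearMap.ker (LinearMap.pi f) ≠ ⊥ :=
    LinearMap.ker_ne_bot_of_finrank_lt (by simpa using h)
  obtain ⟨x, hx, hx0⟩ := Submodule.exists_mem_ne_zero_of_ne_bot hker
  exact ⟨x, hx0, fun k => congrFun (LinearMap.mem_ker.1 hx) k⟩

/-- The Courant–Fischer comparison of phases. If the form of `Sᴴ e^{iφ} S` at `x` agrees with the
form of `Tᴴ e^{iψ} T` at `E x` for all `x` in a subspace of codimension at most `r`, then the
phases satisfy `φ_{i+r} ≤ ψ_i`. A dimension count gives a nonzero `x` in that subspace such that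
`S x` is supported on the indices up to `i + r` and `T E x` on the indices from `i` on, and
`le_of_sum_exp_eq` applies to the common value of the two forms. The hypothesis on `φ ⊥ - ψ ⊤` rules
out phases `φ` that are too large by a multiple of `2π`. -/
lemma phase_le_phase {N : ℕ} [NeZero N] (e : ι ≃ Fin N) (S T E R : Matrix ι ι ℂ)
    (hT : T.det ≠ 0) (hE : E.det ≠ 0) (φ ψ : Fin N → ℝ) (hφ : Antitone φ) (hψ : Antitone ψ)
    (hφπ : φ ⊥ - φ ⊤ < Real.pi) (hψπ : ψ ⊥ - ψ ⊤ < Real.pi) (hφψ : φ ⊥ - ψ ⊤ < 2 * Real.pi)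
    (s : Finset (Fin N)) (r : ℕ) (hs : s.card ≤ r)
    (hform : ∀ x, (∀ k ∈ s, (R *ᵥ x) (e.symm k) = 0) →
      hForm (Sᴴ * expDiag (φ ∘ e) * S) x = hForm (Tᴴ * expDiag (ψ ∘ e) * T) (E *ᵥ x))
    (i : Fin N) (hi : i.val + r < N) : φ ⟨i.val + r, hi⟩ ≤ ψ i := by
  set l : Fin N := ⟨i.val + r, hi⟩ with hl
  let f : (Finset.Ioi l ⊕ s) ⊕ Finset.Iio i → (ι → ℂ) →ₗ[ℂ] ℂ :=
    Sum.elim (Sum.elim (fun k => LinearMap.proj (e.symm k) ∘ₗ S.mulVecLin)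
      (fun k => LinearMap.proj (e.symm k) ∘ₗ R.mulVecLin))
      (fun k => LinearMap.proj (e.symm k) ∘ₗ (T * E).mulVecLin)
  obtain ⟨x, hx0, hx⟩ := exists_ne_zero_of_card_lt f (by
    rw [Fintype.card_congr e]
    simp only [Fintype.card_sum, Fintype.card_coe, Fin.card_Ioi, Fin.card_Iio, Fintype.card_fin]
    simp only [hl]
    omega)
  have hS : ∀ k, l < k → (S *ᵥ x) (e.symm k) = 0 := fun k hk =>
    hx (Sum.inl (Sum.inl ⟨k, Finset.mem_Ioi.2 hk⟩))
  have hR : ∀ k ∈ s, (R *ᵥ x) (e.symm k) = 0 := fun k hk => hx (Sum.inl (Sum.inr ⟨k, hk⟩))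
  have hTE : ∀ k, k < i → (T *ᵥ (E *ᵥ x)) (e.symm k) = 0 := fun k hk => by
    rw [mulVec_mulVec]
    exact hx (Sum.inr ⟨k, Finset.mem_Iio.2 hk⟩)
  have hne : T *ᵥ (E *ᵥ x) ≠ 0 := fun h' =>
    hx0 (eq_zero_of_mulVec_eq_zero hE (eq_zero_of_mulVec_eq_zero hT h'))
  have hsum := hform x hR
  rw [hForm_expDiag, hForm_expDiag] at hsum
  have hl1 := hφ (le_top : l ≤ ⊤)
  have hi1 := hψ (bot_le : ⊥ ≤ i)
  refine le_of_sum_exp_eq _ _ (φ ∘ e) (ψ ∘ e) (fun k => Complex.normSq_nonneg _)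
    (fun k => Complex.normSq_nonneg _) (a := φ ⊥) (b := ψ ⊤) (by linarith) (by linarith) hφψ
    (fun k hk => ⟨hφ ?_, hφ bot_le⟩) (fun k hk => ⟨hψ le_top, hψ ?_⟩) ?_ hsum
  · by_contra! h
    have := hS _ h
    rw [e.symm_apply_apply] at this
    exact hk (by rw [this, map_zero])
  · by_contra! h
    have := hTE _ h
    rw [e.symm_apply_apply] at this
    exact hk (by rw [this, map_zero])
  · obtain ⟨j, hj⟩ := Function.ne_iff.1 hne
    exact ⟨j, (Complex.normSq_pos.2 hj).ne'⟩

end Decomposition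

/-! ### Block-circulant matrices of tensors -/

section Tensors
variable {n p : ℕ}

lemma bcirc_injective {m : ℕ} [NeZero p] :
    Function.Injective (bcirc : Tensor m n p → Matrix (Fin p × Fin m) (Fin p × Fin n) ℂ) := by
  intro A B h
  funext k
  ext i j
  have := congrFun (congrFun h (k, i)) (0, j)
  simpa [bcirc] using this

lemma bcirc_tMul {m s : ℕ} [NeZero p] (A : Tensor m n p) (B : Tensor n s p) :
    bcirc (tMul A B) = bcirc A * bcirc B := by
  ext ⟨k, i⟩ ⟨l, j⟩
  simp only [bcirc, tMul, fold, unfold, mul_apply, of_apply, Fintype.sum_prod_type]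
  refine Fintype.sum_equiv (Equiv.addRight l) _ _ fun q => ?_
  simp only [Equiv.coe_addRight, add_sub_cancel_right, sub_sub, add_comm l q]

lemma bcirc_tOne [NeZero p] : bcirc (tOne n p) = 1 := by
  ext ⟨k, i⟩ ⟨l, j⟩
  have h : (k - l).val = 0 ↔ k = l := by
    rw [← sub_eq_zero (a := k), Fin.ext_iff, Fin.val_zero]
  simp only [bcirc, tOne, of_apply, h]
  by_cases hkl : k = l <;> simp [hkl, Matrix.one_apply]

/-- A tensor with nonsingular block-circulant matrix is T-invertible: the first block column of the
inverse matrix is an inverse tensor. -/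
lemma exists_isTInverse [NeZero p] (A : Tensor n n p) (h : (bcirc A).det ≠ 0) :
    ∃ B, IsTInverse A B := by
  refine ⟨fold ((bcirc A)⁻¹ * unfold (tOne n p)), ?_⟩
  have hu : IsUnit (bcirc A).det := isUnit_iff_ne_zero.2 h
  set B : Tensor n n p := fold ((bcirc A)⁻¹ * unfold (tOne n p)) with hB
  have h1 : tMul A B = tOne n p := by
    change fold (bcirc A * ((bcirc A)⁻¹ * unfold (tOne n p))) = _
    rw [← Matrix.mul_assoc, mul_nonsing_inv _ hu, Matrix.one_mul]
    rfl
  refine ⟨h1, bcirc_injective ?_⟩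
  have h2 := congrArg bcirc h1
  rw [bcirc_tMul, bcirc_tOne] at h2 ⊢
  exact mul_eq_one_comm.1 h2

lemma bcirc_tInv [NeZero p] (A : Tensor n n p) (h : (bcirc A).det ≠ 0) :
    bcirc (tInv A) = (bcirc A)⁻¹ := by
  have hex := exists_isTInverse A h
  have h1 : IsTInverse A (tInv A) := by
    rw [tInv, dif_pos hex]; exact hex.choose_spec
  have h2 := congrArg bcirc h1.1
  rw [bcirc_tMul, bcirc_tOne] at h2
  exact (inv_eq_right_inv h2).symm

lemma bcirc_invSandwich [NeZero n] [NeZero p] (E A : Tensor n n p) (h : (bcirc E).det ≠ 0) :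
    bcirc (invSandwich E A) = (bcirc E)⁻¹ * bcirc A * (bcirc E)⁻¹ := by
  rw [invSandwich, bcirc_tMul, bcirc_tMul, bcirc_tInv E h]

lemma frobInner_tMul (A : Tensor n n p) (x : Fin p × Fin n → ℂ) :
    frobInner (fold (of fun y (_ : Fin 1) => x y)) (tMul A (fold (of fun y _ => x y)))
      = hForm (bcirc A) x := by
  simp [frobInner, tMul, fold, unfold, hForm, dotProduct, mulVec, Fintype.sum_prod_type, mul_apply]

lemma frobNorm_fold (x : Fin p × Fin n → ℂ) :
    frobNorm (fold (of fun y (_ : Fin 1) => x y)) = √(lengthSq x) := by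
  have : frobInner (fold (of fun y (_ : Fin 1) => x y)) (fold (of fun y (_ : Fin 1) => x y))
      = (lengthSq x : ℂ) := by
    simp [frobInner, fold, lengthSq, Fintype.sum_prod_type, Complex.normSq_eq_conj_mul_self]
  rw [frobNorm, this, Complex.ofReal_re]

/-- Sectoriality of a tensor is definiteness of the form of its block-circulant matrix. -/
lemma sectorial_iff (A : Tensor n n p) :
    Sectorial A ↔ ∀ x ≠ 0, hForm (bcirc A) x ≠ 0 := by
  constructor
  · intro h x hx h0
    have hn := lengthSq_pos hx
    refine h ⟨fold (of fun y _ => ((((√(lengthSq x))⁻¹ : ℝ) : ℂ) • x) y), ?_, ?_⟩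
    · rw [frobNorm_fold, lengthSq_smul, Complex.normSq_ofReal, ← mul_inv,
        Real.mul_self_sqrt hn.le, inv_mul_cancel₀ hn.ne', Real.sqrt_one]
    · rw [frobInner_tMul, hForm_smul, h0, mul_zero]
  · rintro h ⟨X, hX, h0⟩
    obtain ⟨x, rfl⟩ : ∃ x : Fin p × Fin n → ℂ, X = fold (of fun y _ => x y) :=
      ⟨fun y => X y.1 y.2 0, by funext k; ext i j; rw [Subsingleton.elim j 0]; rfl⟩
    rw [frobInner_tMul] at h0
    refine h x ?_ h0.symm
    rintro rfl
    rw [frobNorm_fold] at hX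
    simp [lengthSq] at hX

lemma det_bcirc_ne_zero {A : Tensor n n p} (h : Sectorial A) : (bcirc A).det ≠ 0 := by
  intro h0
  obtain ⟨x, hx, hx0⟩ := exists_mulVec_eq_zero_iff.2 h0
  exact (sectorial_iff A).1 h x hx (by rw [hForm, hx0, dotProduct_zero])

end Tensors

/-! ### Block diagonalization by the discrete Fourier transform -/

section Fourier
variable {n p : ℕ} [NeZero p]

/-- The value of the discrete Fourier transform of the sequence of frontal slices at a character of
`ℤ / p`: the corresponding diagonal block of the block-diagonalized matrix `bcirc A`. -/
def fourierBlock (A : Tensor n n p) (ψ : AddChar (Fin p) ℂ) : Matrix (Fin n) (Fin n) ℂ :=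
  ∑ m, ψ m • A m

/-- The product of the block-diagonal matrix with blocks `T ψ` and the unitary block Fourier
matrix. Its rows are indexed by the characters of `ℤ / p` and the rows of the blocks. -/
def fourierFactor (T : AddChar (Fin p) ℂ → Matrix (Fin n) (Fin n) ℂ) :
    Matrix (AddChar (Fin p) ℂ × Fin n) (Fin p × Fin n) ℂ :=
  of fun a y => ((√p)⁻¹ : ℝ) * a.1 y.1 * T a.1 a.2 y.2

lemma fourierFactor_mul_apply (T : AddChar (Fin p) ℂ → Matrix (Fin n) (Fin n) ℂ)
    (d : AddChar (Fin p) ℂ × Fin n → ℂ) (x y : Fin p × Fin n) :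
    ((fourierFactor T)ᴴ * diagonal d * fourierFactor T) x y =
      (p : ℂ)⁻¹ * ∑ ψ, ψ (-(x.1 - y.1)) *
        ((T ψ)ᴴ * diagonal (fun s => d (ψ, s)) * T ψ) x.2 y.2 := by
  have hp : (((√p)⁻¹ : ℝ) : ℂ) * (((√p)⁻¹ : ℝ) : ℂ) = (p : ℂ)⁻¹ := by
    rw [← Complex.ofReal_mul, ← mul_inv, Real.mul_self_sqrt (Nat.cast_nonneg p)]
    push_cast; rfl
  rw [mul_apply, Fintype.sum_prod_type, Finset.mul_sum]
  refine Finset.sum_congr rfl fun ψ _ => ?_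
  rw [mul_apply, Finset.mul_sum, Finset.mul_sum]
  refine Finset.sum_congr rfl fun s _ => ?_
  have h1 : ψ (-(x.1 - y.1)) = star (ψ x.1) * ψ y.1 := by
    rw [neg_sub, sub_eq_neg_add, AddChar.map_add_eq_mul, AddChar.map_neg_eq_conj]; rfl
  rw [mul_diagonal, mul_diagonal, h1, ← hp]
  simp only [conjTranspose_apply, fourierFactor, of_apply, star_mul', Complex.star_def,
    Complex.conj_ofReal]
  ring

/-- Conjugating a diagonal matrix by a Fourier factor gives a block-circulant matrix. -/
lemma exists_bcirc_eq_fourierFactor (T : AddChar (Fin p) ℂ → Matrix (Fin n) (Fin n) ℂ)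
    (d : AddChar (Fin p) ℂ × Fin n → ℂ) :
    ∃ E : Tensor n n p, bcirc E = (fourierFactor T)ᴴ * diagonal d * fourierFactor T := by
  refine ⟨fun k => of fun i j => (p : ℂ)⁻¹ * ∑ ψ : AddChar (Fin p) ℂ, ψ (-k) *
    ((T ψ)ᴴ * diagonal (fun s => d (ψ, s)) * T ψ) i j, ?_⟩
  ext x y
  rw [fourierFactor_mul_apply]
  rfl

/-- Decompositions of all Fourier blocks combine to one of the block-circulant matrix, by the
orthogonality of characters. -/
lemma bcirc_eq_fourierFactor (A : Tensor n n p)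
    (T : AddChar (Fin p) ℂ → Matrix (Fin n) (Fin n) ℂ) (d : AddChar (Fin p) ℂ × Fin n → ℂ)
    (h : ∀ ψ, fourierBlock A ψ = (T ψ)ᴴ * diagonal (fun s => d (ψ, s)) * T ψ) :
    bcirc A = (fourierFactor T)ᴴ * diagonal d * fourierFactor T := by
  ext x y
  rw [fourierFactor_mul_apply]
  simp_rw [← h, fourierBlock, Matrix.sum_apply, Matrix.smul_apply, smul_eq_mul, Finset.mul_sum]
  rw [Finset.sum_comm]
  have h1 : ∀ m : Fin p, ∑ ψ : AddChar (Fin p) ℂ,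
      (p : ℂ)⁻¹ * (ψ (-(x.1 - y.1)) * (ψ m * A m x.2 y.2)) =
      if m = x.1 - y.1 then A m x.2 y.2 else 0 := by
    intro m
    have h2 : ∀ ψ : AddChar (Fin p) ℂ, (p : ℂ)⁻¹ * (ψ (-(x.1 - y.1)) * (ψ m * A m x.2 y.2))
        = ψ (m - (x.1 - y.1)) * ((p : ℂ)⁻¹ * A m x.2 y.2) := by
      intro ψ
      rw [sub_eq_neg_add m, AddChar.map_add_eq_mul]; ring
    simp_rw [h2]
    rw [← Finset.sum_mul, AddChar.sum_apply_eq_ite, Fintype.card_fin]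
    simp only [sub_eq_zero]
    split_ifs
    · have : (p : ℂ) ≠ 0 := Nat.cast_ne_zero.2 (NeZero.ne p)
      field_simp
    · simp
  simp_rw [h1]
  simp [bcirc]

/-- The form of a Fourier block is, up to the factor `p`, the form of `bcirc A` on the vectors
`ψ⁻¹ ⊗ v`. -/
lemma hForm_fourierBlock (A : Tensor n n p) (ψ : AddChar (Fin p) ℂ) (v : Fin n → ℂ) :
    hForm (bcirc A) (fun y => ψ (-y.1) * v y.2) = p * hForm (fourierBlock A ψ) v := by
  have h1 : hForm (bcirc A) (fun y => ψ (-y.1) * v y.2)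
      = ∑ l : Fin p, ∑ k : Fin p, ψ (k - l) * hForm (A (k - l)) v := by
    rw [Finset.sum_comm]
    simp only [hForm, dotProduct, mulVec, Fintype.sum_prod_type, Pi.star_apply, bcirc, of_apply,
      Finset.mul_sum]
    refine Finset.sum_congr rfl fun k _ => ?_
    rw [Finset.sum_comm]
    refine Finset.sum_congr rfl fun l _ => ?_
    refine Finset.sum_congr rfl fun i _ => ?_
    refine Finset.sum_congr rfl fun j _ => ?_
    have h2 : ψ (k - l) = star (ψ (-k)) * ψ (-l) := by
      rw [sub_eq_add_neg, AddChar.map_add_eq_mul, AddChar.map_neg_eq_conj ψ k]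
      simp
    rw [h2, star_mul']
    ring
  have h3 : ∀ l : Fin p, ∑ k : Fin p, ψ (k - l) * hForm (A (k - l)) v
      = hForm (fourierBlock A ψ) v := by
    intro l
    refine (Equiv.sum_comp (Equiv.subRight l) (fun m => ψ m * hForm (A m) v)).trans ?_
    simp only [hForm, fourierBlock, sum_mulVec, dotProduct_sum, smul_mulVec, dotProduct_smul,
      smul_eq_mul]
  rw [h1]
  simp_rw [h3]
  simp

end Fourier

/-! ### Existence and uniqueness of canonical phases -/

section Canonical

lemma exp_I_add_int_mul (t : ℝ) (m : ℤ) :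
    Complex.exp (Complex.I * ((t + m * (2 * Real.pi) : ℝ) : ℂ)) =
      Complex.exp (Complex.I * (t : ℂ)) := by
  have : Complex.I * ((t + m * (2 * Real.pi) : ℝ) : ℂ)
      = Complex.I * (t : ℂ) + m * (2 * Real.pi * Complex.I) := by push_cast; ring
  rw [this, Complex.exp_add, Complex.exp_int_mul_two_pi_mul_I, mul_one]

lemma exists_int_add_mem_Ioc (a t : ℝ) :
    ∃ m : ℤ, t + m * (2 * Real.pi) ∈ Set.Ioc a (a + 2 * Real.pi) := by
  obtain ⟨m, hm, -⟩ := existsUnique_add_zsmul_mem_Ioc Real.two_pi_pos t a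
  exact ⟨m, by simpa using hm⟩

/-- Any finite family of reals can be enumerated in nonincreasing order. -/
lemma exists_equiv_antitone {κ : Type*} [Fintype κ] {N : ℕ} (hN : Fintype.card κ = N)
    (f : κ → ℝ) : ∃ e : Fin N ≃ κ, Antitone (f ∘ e) := by
  let e₁ : Fin N ≃ κ := (Fintype.equivFinOfCardEq hN).symm
  refine ⟨(Tuple.sort (fun k => -f (e₁ k))).trans e₁, fun i j hij => ?_⟩
  have := Tuple.monotone_sort (fun k => -f (e₁ k)) hij
  simpa using this

variable {n p : ℕ} [NeZero n] [NeZero p]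

/-- A sectorial tensor has a canonical phase vector and a decomposition `Tᴴ D T` such that every
`Tᴴ D' T` with `D'` diagonal is again block-circulant. The half-plane containing the form values of
`bcirc A` also contains those of all Fourier blocks, so these can be decomposed separately. -/
theorem exists_canonical (A : Tensor n n p) (hA : Sectorial A) :
    ∃ (T : Matrix (Fin p × Fin n) (Fin p × Fin n) ℂ) (φ : Fin (p * n) → ℝ),
      IsCanonicalPhaseVector A φ ∧ IsSectorialDecomposition A T φ ∧
      ∀ d, ∃ E : Tensor n n p, bcirc E = Tᴴ * diagMat d * T := by
  obtain ⟨θ, hθ⟩ := exists_rotation_re_pos _ ((sectorial_iff A).1 hA)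
  have hblock : ∀ ψ : AddChar (Fin p) ℂ, ∃ (T : Matrix (Fin n) (Fin n) ℂ) (φ : Fin n → ℝ),
      (∀ k, |φ k - θ| < Real.pi / 2) ∧ fourierBlock A ψ = Tᴴ * expDiag φ * T := by
    intro ψ
    refine exists_expDiag_of_re_pos _ θ fun v hv => ?_
    obtain ⟨i, hi⟩ := Function.ne_iff.1 hv
    have h1 := hθ (fun y => ψ (-y.1) * v y.2) (Function.ne_iff.2 ⟨(0, i), by simpa using hi⟩)
    rw [hForm_fourierBlock, mul_left_comm, ← Complex.ofReal_natCast, Complex.re_ofReal_mul] at h1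
    exact pos_of_mul_pos_right h1 (Nat.cast_nonneg p)
  choose S φ₀ hφ₀ hS using hblock
  obtain ⟨e, he⟩ := exists_equiv_antitone (κ := AddChar (Fin p) ℂ × Fin n) (N := p * n)
    (by simp) (fun a => φ₀ a.1 a.2)
  set φ₁ : Fin (p * n) → ℝ := fun k => φ₀ (e k).1 (e k).2 with hφ₁
  have hanti : Antitone φ₁ := he
  have habs : ∀ k, |φ₁ k - θ| < Real.pi / 2 := fun k => hφ₀ _ _
  -- A common shift by `2πm` puts the centre into `(-π, π]`.
  obtain ⟨m, hm⟩ := exists_int_add_mem_Ioc (-Real.pi) ((φ₁ ⊥ + φ₁ ⊤) / 2)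
  set ε : Fin p × Fin n ≃ AddChar (Fin p) ℂ × Fin n := finProdFinEquiv.trans e with hε
  have hT : ∀ d : Fin (p * n) → ℂ,
      ((fourierFactor S).submatrix ε id)ᴴ * diagMat d * (fourierFactor S).submatrix ε id
        = (fourierFactor S)ᴴ * diagonal (d ∘ e.symm) * fourierFactor S := by
    intro d
    have : diagMat d = (diagonal (d ∘ e.symm)).submatrix ε ε := by
      rw [submatrix_diagonal_equiv, diagMat]
      congr 1
      ext x; simp [hε]
    rw [this, conjTranspose_submatrix, submatrix_mul_equiv, submatrix_mul_equiv, submatrix_id_id]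
  set T := (fourierFactor S).submatrix ε id with hTdef
  have hdec : bcirc A = Tᴴ *
      diagMat (fun k => Complex.exp (Complex.I * ((φ₁ k + m * (2 * Real.pi) : ℝ) : ℂ))) * T := by
    rw [hT]
    refine bcirc_eq_fourierFactor A S _ fun ψ => ?_
    rw [hS, expDiag]
    congr 3
    ext s
    simp only [Function.comp_apply, exp_I_add_int_mul]
    simp [hφ₁]
  have hsd : IsSectorialDecomposition A T (fun k => φ₁ k + m * (2 * Real.pi)) := by
    refine ⟨fun h0 => det_bcirc_ne_zero hA ?_, hdec⟩
    rw [hdec, det_mul, h0, mul_zero]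
  refine ⟨T, fun k => φ₁ k + m * (2 * Real.pi), ⟨?_, ?_, ?_, T, hsd⟩, hsd, fun d => ?_⟩
  · intro i j hij
    simpa using hanti hij
  · have h1 := abs_lt.1 (habs ⊥)
    have h2 := abs_lt.1 (habs ⊤)
    dsimp only
    linarith
  · rw [show -Real.pi + 2 * Real.pi = Real.pi by ring] at hm
    convert hm using 1
    ring
  · rw [hT]
    exact exists_bcirc_eq_fourierFactor S _

omit [NeZero n] [NeZero p] in
lemma IsSectorialDecomposition.bcirc_eq {A : Tensor n n p}
    {T : Matrix (Fin p × Fin n) (Fin p × Fin n) ℂ} {φ : Fin (p * n) → ℝ}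
    (h : IsSectorialDecomposition A T φ) :
    bcirc A = Tᴴ * expDiag (φ ∘ finProdFinEquiv) * T := h.2

/-- Comparison of the phases of two decompositions of the same tensor. -/
lemma IsSectorialDecomposition.phase_le {A : Tensor n n p}
    {S T : Matrix (Fin p × Fin n) (Fin p × Fin n) ℂ} {φ ψ : Fin (p * n) → ℝ}
    (hS : IsSectorialDecomposition A S φ) (hT : IsSectorialDecomposition A T ψ)
    (hφ : Antitone φ) (hψ : Antitone ψ)
    (hφπ : φ ⊥ - φ ⊤ < Real.pi) (hψπ : ψ ⊥ - ψ ⊤ < Real.pi) (hφψ : φ ⊥ - ψ ⊤ < 2 * Real.pi) :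
    φ ≤ ψ := by
  intro i
  refine phase_le_phase finProdFinEquiv S T 1 1 hT.1 (by simp) φ ψ hφ hψ hφπ hψπ hφψ ∅ 0 (by simp)
    (fun x _ => ?_) i i.2
  rw [← hS.bcirc_eq, ← hT.bcirc_eq, one_mulVec]

/-- Canonical phase vectors are unique. After a shift by a multiple of `2π` the centres of two of
them differ by at most `π`; then each bounds the other by `IsSectorialDecomposition.phase_le`, and
the normalization of the centres shows that the shift was trivial. -/
theorem IsCanonicalPhaseVector.unique {A : Tensor n n p} {φ ψ : Fin (p * n) → ℝ}
    (hφ : IsCanonicalPhaseVector A φ) (hψ : IsCanonicalPhaseVector A ψ) : φ = ψ := by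
  obtain ⟨hφ1, hφ2, hφ3, S, hS⟩ := hφ
  obtain ⟨hψ1, hψ2, hψ3, T, hT⟩ := hψ
  obtain ⟨m, hm1, hm2⟩ := exists_int_add_mem_Ioc ((φ ⊥ + φ ⊤) / 2 - Real.pi) ((ψ ⊥ + ψ ⊤) / 2)
  set ψ' : Fin (p * n) → ℝ := fun k => ψ k + m * (2 * Real.pi) with hψ'
  have hT' : IsSectorialDecomposition A T ψ' := by
    refine ⟨hT.1, ?_⟩
    rw [hT.2]
    simp only [hψ', exp_I_add_int_mul]
  have hanti : Antitone ψ' := fun i j hij => by simpa [hψ'] using hψ1 hij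
  have e1 : ψ' ⊥ = ψ ⊥ + m * (2 * Real.pi) := rfl
  have e2 : ψ' ⊤ = ψ ⊤ + m * (2 * Real.pi) := rfl
  have heq : φ = ψ' := le_antisymm
    (hS.phase_le hT' hφ1 hanti hφ2 (by linarith) (by linarith))
    (hT'.phase_le hS hanti hφ1 (by linarith) hφ2 (by linarith))
  have e3 : (φ ⊥ + φ ⊤) / 2 = (ψ ⊥ + ψ ⊤) / 2 + m * (2 * Real.pi) := by
    rw [heq, e1, e2]; ring
  have hm0 : m = 0 := by
    have hπ := Real.pi_pos
    have h1 : (m : ℝ) < 1 := by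
      by_contra! h
      nlinarith [hφ3.2, hψ3.1]
    have h2 : (-1 : ℝ) < m := by
      by_contra! h
      nlinarith [hφ3.1, hψ3.2]
    have h1' : m < 1 := by exact_mod_cast h1
    have h2' : -1 < m := by exact_mod_cast h2
    omega
  rw [heq, hψ', hm0]
  simp

lemma isCanonicalPhaseVector_phase {A : Tensor n n p} (hA : Sectorial A) :
    IsCanonicalPhaseVector A (phase A) := by
  obtain ⟨-, φ, hφ, -⟩ := exists_canonical A hA
  have hex : ∃ φ, IsCanonicalPhaseVector A φ := ⟨φ, hφ⟩
  rw [phase, dif_pos hex]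
  exact hex.choose_spec

lemma IsCanonicalPhaseVector.phase_eq {A : Tensor n n p} {φ : Fin (p * n) → ℝ}
    (h : IsCanonicalPhaseVector A φ) : phase A = φ := by
  have hex : ∃ φ, IsCanonicalPhaseVector A φ := ⟨φ, h⟩
  rw [phase, dif_pos hex]
  exact hex.choose_spec.unique h

/-- A tensor with a canonical phase vector is sectorial, since its phases lie in an open
half-circle. -/
lemma IsCanonicalPhaseVector.sectorial {A : Tensor n n p} {φ : Fin (p * n) → ℝ}
    (h : IsCanonicalPhaseVector A φ) : Sectorial A := by
  obtain ⟨h1, h2, -, T, hT⟩ := h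
  rw [sectorial_iff, hT.bcirc_eq]
  intro x hx
  refine hForm_expDiag_ne_zero T hT.1 _ ((φ ⊥ + φ ⊤) / 2) (fun k => ?_) hx
  have h3 : φ (finProdFinEquiv k) ≤ φ ⊥ := h1 bot_le
  have h4 : φ ⊤ ≤ φ (finProdFinEquiv k) := h1 le_top
  rw [Function.comp_apply, abs_lt]
  constructor <;> linarith

end Canonical

/-! ### Monotonicity of symmetric gauge functions -/

section Gauge

lemma IsSymmetricGauge.update_le {N : ℕ} {Ψ : (Fin N → ℝ) → ℝ} (hΨ : IsSymmetricGauge Ψ)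
    (y : Fin N → ℝ) (j : Fin N) {a : ℝ} (ha : |a| ≤ y j) : Ψ (Function.update y j a) ≤ Ψ y := by
  rcases (abs_nonneg a |>.trans ha).eq_or_lt with h0 | hpos
  · have : a = y j := by
      rw [← h0] at ha ⊢
      exact abs_eq_zero.1 (le_antisymm ha (abs_nonneg a))
    rw [this, Function.update_eq_self]
  -- `update y j a` is a convex combination of `y` and its reflection in the coordinate `j`.
  set t : ℝ := a / y j with ht
  have hta : t * y j = a := div_mul_cancel₀ _ hpos.ne'
  have ht1 : |t| ≤ 1 := by
    rw [ht, abs_div, abs_of_pos hpos]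
    exact (div_le_one hpos).2 ha
  obtain ⟨hl, hu⟩ := abs_le.1 ht1
  set s : Fin N → ℝ := fun i => if i = j then -1 else 1 with hs
  have hrefl : Ψ (fun i => s i * y i) = Ψ y :=
    hΨ.signed_perm 1 s (fun i => by by_cases h : i = j <;> simp [hs, h]) y
  have hcomb : Function.update y j a =
      ((1 + t) / 2) • y + ((1 - t) / 2) • (fun i => s i * y i) := by
    ext i
    by_cases h : i = j
    · subst h
      simp only [Function.update_self, Pi.add_apply, Pi.smul_apply, smul_eq_mul, hs, if_true]
      rw [← hta]; ring
    · simp only [Function.update_of_ne h, Pi.add_apply, Pi.smul_apply, smul_eq_mul, hs, if_neg h]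
      ring
  calc Ψ (Function.update y j a)
      ≤ Ψ (((1 + t) / 2) • y) + Ψ (((1 - t) / 2) • (fun i => s i * y i)) := by
        rw [hcomb]; exact hΨ.add_le _ _
    _ = Ψ y := by
        rw [hΨ.smul, hΨ.smul, hrefl, abs_of_nonneg (by linarith), abs_of_nonneg (by linarith)]
        ring

/-- Symmetric gauge functions are monotone on the nonnegative orthant. -/
lemma IsSymmetricGauge.mono {N : ℕ} {Ψ : (Fin N → ℝ) → ℝ} (hΨ : IsSymmetricGauge Ψ)
    {x y : Fin N → ℝ} (hx : 0 ≤ x) (hxy : x ≤ y) : Ψ x ≤ Ψ y := by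
  have key : ∀ s : Finset (Fin N), Ψ (s.piecewise x y) ≤ Ψ y := by
    intro s
    induction s using Finset.induction_on with
    | empty => simp
    | insert j s hj ih =>
      rw [Finset.piecewise_insert]
      refine (hΨ.update_le _ j ?_).trans ih
      rw [Finset.piecewise_eq_of_notMem _ _ _ hj, abs_of_nonneg (hx j)]
      exact hxy j
  simpa using key Finset.univ

end Gauge

/-! ### Phases of half-phase truncations and the lower bound -/

section Approximation
variable {n p : ℕ} [NeZero n] [NeZero p]

lemma isSectorialDecomposition_phase {A : Tensor n n p} (hA : Sectorial A) :
    ∃ T, IsSectorialDecomposition A T (phase A) := (isCanonicalPhaseVector_phase hA).2.2.2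

lemma antitone_phase {A : Tensor n n p} (hA : Sectorial A) : Antitone (phase A) :=
  (isCanonicalPhaseVector_phase hA).1

lemma InSectorIco.phase_nonneg {A : Tensor n n p} (hA : InSectorIco A 0 Real.pi)
    (k : Fin (p * n)) : 0 ≤ phase A k := by
  have h := antitone_phase hA.1
  exact (hA.2 ⟨le_rfl, h bot_le⟩).1.trans (h le_top)

lemma InSectorIco.phase_lt_pi {A : Tensor n n p} (hA : InSectorIco A 0 Real.pi)
    (k : Fin (p * n)) : phase A k < Real.pi := by
  have h := antitone_phase hA.1
  exact (h bot_le).trans_lt (hA.2 ⟨h bot_le, le_rfl⟩).2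

/-- A decomposition with ordered phases in `[0, π)` is canonical. -/
lemma IsSectorialDecomposition.isCanonicalPhaseVector {A : Tensor n n p}
    {T : Matrix (Fin p × Fin n) (Fin p × Fin n) ℂ} {φ : Fin (p * n) → ℝ}
    (h : IsSectorialDecomposition A T φ) (hφ : Antitone φ) (h0 : ∀ k, 0 ≤ φ k)
    (hπ : ∀ k, φ k < Real.pi) : IsCanonicalPhaseVector A φ := by
  have h1 := h0 ⊤
  have h2 := h0 ⊥
  have h3 := hπ ⊤
  have h4 := hπ ⊥
  refine ⟨hφ, by linarith, ⟨by linarith, by linarith⟩, T, h⟩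

lemma IsCanonicalPhaseVector.inSectorIco {A : Tensor n n p} {φ : Fin (p * n) → ℝ}
    (h : IsCanonicalPhaseVector A φ) (h0 : ∀ k, 0 ≤ φ k) (hπ : ∀ k, φ k < Real.pi) :
    InSectorIco A 0 Real.pi := by
  refine ⟨h.sectorial, ?_⟩
  rw [h.phase_eq]
  exact fun t ht => ⟨(h0 _).trans ht.1, ht.2.trans_lt (hπ _)⟩

omit [NeZero n] [NeZero p] in
/-- Reordering the phases amounts to reordering the rows of the congruence factor. -/
lemma IsSectorialDecomposition.perm {A : Tensor n n p}
    {T : Matrix (Fin p × Fin n) (Fin p × Fin n) ℂ} {φ : Fin (p * n) → ℝ}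
    (h : IsSectorialDecomposition A T φ) (σ : Equiv.Perm (Fin (p * n))) :
    ∃ S, IsSectorialDecomposition A S (φ ∘ σ) := by
  set τ : Equiv.Perm (Fin p × Fin n) :=
    (finProdFinEquiv.trans σ).trans finProdFinEquiv.symm with hτ
  refine ⟨T.submatrix τ id, ?_, ?_⟩
  · rw [det_permute]
    refine mul_ne_zero ?_ h.1
    exact_mod_cast Units.ne_zero (Equiv.Perm.sign τ)
  · have : diagMat (fun k => Complex.exp (Complex.I * ((φ ∘ σ) k : ℂ))) =
        (diagMat (fun k => Complex.exp (Complex.I * (φ k : ℂ)))).submatrix τ τ := by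
      rw [diagMat, diagMat, submatrix_diagonal_equiv]
      congr 1
      ext x; simp [hτ, -finProdFinEquiv_symm_apply]
    rw [this, conjTranspose_submatrix, submatrix_mul_equiv, submatrix_mul_equiv, submatrix_id_id]
    exact h.2

/-- The phases of a half-phase truncation. -/
def halfPhases (A : Tensor n n p) (r : ℕ) : Fin (p * n) → ℝ :=
  fun k => if k.val < r then phase A k / 2 else 0

lemma halfPhaseDiag_eq (A : Tensor n n p) (r : ℕ) :
    halfPhaseDiag A r = fun k => Complex.exp (Complex.I * (halfPhases A r k : ℂ)) := by
  ext k
  by_cases h : k.val < r <;> simp [halfPhaseDiag, halfPhases, h]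

lemma isCanonicalPhaseVector_halfPhases {A E : Tensor n n p} (hA : InSectorIco A 0 Real.pi)
    {r : ℕ} (hE : E ∈ halfTruncations A r) : IsCanonicalPhaseVector E (halfPhases A r) := by
  obtain ⟨T, hT, hET⟩ := hE
  rw [halfPhaseDiag_eq] at hET
  refine IsSectorialDecomposition.isCanonicalPhaseVector ⟨hT.1, hET⟩ ?_ ?_ ?_
  · intro i j hij
    have h1 := antitone_phase hA.1 hij
    have h2 := hA.phase_nonneg i
    have h3 : i.val ≤ j.val := hij
    simp only [halfPhases]
    split_ifs
    · linarith
    · omega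
    · linarith
    · exact le_rfl
  · intro k
    have := hA.phase_nonneg k
    simp only [halfPhases]
    split_ifs <;> linarith
  · intro k
    have := hA.phase_lt_pi k
    have := Real.pi_pos
    simp only [halfPhases]
    split_ifs <;> linarith

lemma tailPhases_nonneg {A : Tensor n n p} (hA : InSectorIco A 0 Real.pi) (r : ℕ)
    (k : Fin (p * n)) : 0 ≤ tailPhases A r k := by
  simp only [tailPhases]
  split_ifs
  · exact hA.phase_nonneg _
  · exact le_rfl

/-- The phases of `E⁻¹ * A * E⁻¹` for a half-phase truncation `E`: the two factors `E⁻¹` cancel the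
first `r` phases of `A`, and a cyclic shift of the coordinates orders the remaining vector. -/
lemma isCanonicalPhaseVector_tailPhases {A E : Tensor n n p} (hA : InSectorIco A 0 Real.pi)
    {r : ℕ} (hr : r ≤ p * n) (hE : E ∈ halfTruncations A r) :
    IsCanonicalPhaseVector (invSandwich E A) (tailPhases A r) := by
  have hEdet := det_bcirc_ne_zero (isCanonicalPhaseVector_halfPhases hA hE).sectorial
  obtain ⟨T, hT, hET⟩ := hE
  have hu : IsUnit T.det := isUnit_iff_ne_zero.2 hT.1
  rw [halfPhaseDiag_eq] at hET
  set W : Matrix (Fin p × Fin n) (Fin p × Fin n) ℂ := (T⁻¹)ᴴ with hW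
  have hWH : Wᴴ = T⁻¹ := conjTranspose_conjTranspose _
  have hTW : Tᴴ * W = 1 := by
    rw [hW, ← conjTranspose_mul, nonsing_inv_mul _ hu, conjTranspose_one]
  have hWT : W * Tᴴ = 1 := mul_eq_one_comm.1 hTW
  have hTT : T * T⁻¹ = 1 := mul_nonsing_inv _ hu
  set Dh : (Fin (p * n) → ℝ) → Matrix (Fin p × Fin n) (Fin p × Fin n) ℂ :=
    fun φ => diagMat (fun k => Complex.exp (Complex.I * (φ k : ℂ))) with hDh
  have hmul : ∀ φ ψ, Dh φ * Dh ψ = Dh (φ + ψ) := by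
    intro φ ψ
    simp only [hDh, diagMat, diagonal_mul_diagonal, ← Complex.exp_add, Pi.add_apply,
      Complex.ofReal_add, mul_add]
  have hzero : Dh 0 = 1 := by simp [hDh, diagMat]
  have hEinv : (bcirc E)⁻¹ = T⁻¹ * Dh (-halfPhases A r) * W := by
    refine inv_eq_right_inv ?_
    rw [hET]
    calc Tᴴ * Dh (halfPhases A r) * T * (T⁻¹ * Dh (-halfPhases A r) * W)
        = Tᴴ * (Dh (halfPhases A r) * (T * T⁻¹) * Dh (-halfPhases A r)) * W := by
          simp only [Matrix.mul_assoc]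
      _ = 1 := by
          rw [hTT, Matrix.mul_one, hmul, add_neg_cancel, hzero, Matrix.mul_one, hTW]
  set χ : Fin (p * n) → ℝ := fun k => if k.val < r then 0 else phase A k with hχ
  have hχeq : -halfPhases A r + phase A + -halfPhases A r = χ := by
    ext k
    simp only [hχ, halfPhases, Pi.add_apply, Pi.neg_apply]
    split_ifs <;> ring
  have hdec : IsSectorialDecomposition (invSandwich E A) W χ := by
    refine ⟨?_, ?_⟩
    · intro h0
      have := congrArg det hTW
      rw [det_mul, h0, mul_zero, det_one] at this
      exact zero_ne_one this
    · rw [bcirc_invSandwich E A hEdet, hEinv, hT.2, hWH]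
      change _ = T⁻¹ * Dh χ * W
      change T⁻¹ * Dh (-halfPhases A r) * W * (Tᴴ * Dh (phase A) * T) *
        (T⁻¹ * Dh (-halfPhases A r) * W) = _
      calc _ = T⁻¹ * (Dh (-halfPhases A r) * (W * Tᴴ) * Dh (phase A) * (T * T⁻¹) *
            Dh (-halfPhases A r)) * W := by simp only [Matrix.mul_assoc]
        _ = _ := by rw [hWT, hTT, Matrix.mul_one, Matrix.mul_one, hmul, hmul, hχeq]
  obtain ⟨S, hS⟩ := hdec.perm (Equiv.addRight (Fin.ofNat (p * n) r))
  have htail : χ ∘ (Equiv.addRight (Fin.ofNat (p * n) r)) = tailPhases A r := by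
    ext i
    have hi := i.isLt
    have hval : (i + Fin.ofNat (p * n) r).val = (i.val + r) % (p * n) := by
      rw [Fin.val_add, Fin.val_ofNat, Nat.add_mod_mod]
    -- The shifted index `(i + r) mod np` is below `r` exactly when it has wrapped around.
    simp only [Function.comp_apply, Equiv.coe_addRight, hχ, tailPhases, hval]
    by_cases h : i.val + r < p * n
    · rw [dif_pos h, Nat.mod_eq_of_lt h, if_neg (by omega)]
      congr 1
      exact Fin.ext (by rw [hval, Nat.mod_eq_of_lt h])
    · rw [dif_neg h, if_pos]
      rw [Nat.mod_eq_sub_mod (by omega), Nat.mod_eq_of_lt (by omega)]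
      omega
  rw [htail] at hS
  refine hS.isCanonicalPhaseVector ?_ (tailPhases_nonneg hA r) ?_
  · intro i j hij
    have h3 : i.val ≤ j.val := hij
    simp only [tailPhases]
    split_ifs
    · exact antitone_phase hA.1 (by simpa using h3)
    · omega
    · exact hA.phase_nonneg _
    · exact le_rfl
  · intro k
    simp only [tailPhases]
    split_ifs
    · exact hA.phase_lt_pi _
    · exact Real.pi_pos

/-- The half-phase truncations are feasible. -/
lemma mem_feasible_of_mem_halfTruncations {A E : Tensor n n p} (hA : InSectorIco A 0 Real.pi)
    {r : ℕ} (hr : r ≤ p * n) (hE : E ∈ halfTruncations A r) : E ∈ feasible A r := by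
  have h1 := isCanonicalPhaseVector_halfPhases hA hE
  have h2 := isCanonicalPhaseVector_tailPhases hA hr hE
  refine ⟨h2.inSectorIco (tailPhases_nonneg hA r) fun k => ?_, h1.sectorial, ?_⟩
  · simp only [tailPhases]
    split_ifs
    · exact hA.phase_lt_pi _
    · exact Real.pi_pos
  · rw [tpRank, h1.phase_eq]
    calc _ ≤ (Finset.univ.filter fun k : Fin (p * n) => k.val < r).card := by
          refine Finset.card_le_card fun k hk => ?_
          simp only [Finset.mem_filter, Finset.mem_univ, true_and] at hk ⊢
          by_contra h
          exact hk (by simp [halfPhases, h])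
      _ ≤ r := by
          rw [Fin.card_filter_val_lt]
          exact min_le_right _ _

omit [NeZero n] [NeZero p] in
lemma IsSectorialDecomposition.mulVec_eq {E : Tensor n n p}
    {T : Matrix (Fin p × Fin n) (Fin p × Fin n) ℂ} {φ : Fin (p * n) → ℝ}
    (h : IsSectorialDecomposition E T φ) {x : Fin p × Fin n → ℂ}
    (hx : ∀ k, φ k ≠ 0 → (T *ᵥ x) (finProdFinEquiv.symm k) = 0) :
    bcirc E *ᵥ x = Tᴴ *ᵥ (T *ᵥ x) ∧ (bcirc E)ᴴ *ᵥ x = Tᴴ *ᵥ (T *ᵥ x) := by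
  have hx' : ∀ y, φ (finProdFinEquiv y) ≠ 0 → (T *ᵥ x) y = 0 := fun y hy => by
    simpa using hx _ hy
  constructor
  · rw [h.2, ← mulVec_mulVec, ← mulVec_mulVec]
    congr 1
    ext y
    rw [diagMat, mulVec_diagonal]
    by_cases hy : φ (finProdFinEquiv y) = 0
    · simp [hy]
    · simp [hx' y hy]
  · rw [h.2, conjTranspose_mul, conjTranspose_mul, conjTranspose_conjTranspose,
      ← mulVec_mulVec, ← mulVec_mulVec]
    congr 1
    ext y
    rw [diagMat, diagonal_conjTranspose, mulVec_diagonal]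
    by_cases hy : φ (finProdFinEquiv y) = 0
    · simp [hy]
    · simp [hx' y hy]

/-- The lower bound. On the vectors `x` for which the coordinates of `T x` with nonzero phase
vanish, where `E = Tᴴ D T`, the matrices `E` and `Eᴴ` agree. There the form of `A = E B E` at `x` is
the form of `B = E⁻¹ A E⁻¹` at `E x`, so that `phase_le_phase` applies. -/
lemma tailPhases_le_phase {A E : Tensor n n p} (hA : InSectorIco A 0 Real.pi) {r : ℕ}
    (hE : E ∈ feasible A r) : tailPhases A r ≤ phase (invSandwich E A) := by
  obtain ⟨hB, hEs, hrank⟩ := hE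
  have hEdet := det_bcirc_ne_zero hEs
  have hu : IsUnit (bcirc E).det := isUnit_iff_ne_zero.2 hEdet
  obtain ⟨S, hS⟩ := isSectorialDecomposition_phase hA.1
  obtain ⟨T, hT⟩ := isSectorialDecomposition_phase hB.1
  obtain ⟨R, hR⟩ := isSectorialDecomposition_phase hEs
  have hAB : bcirc A = bcirc E * bcirc (invSandwich E A) * bcirc E := by
    rw [bcirc_invSandwich E A hEdet]
    calc bcirc A = (bcirc E * (bcirc E)⁻¹) * bcirc A * ((bcirc E)⁻¹ * bcirc E) := by
          rw [mul_nonsing_inv _ hu, nonsing_inv_mul _ hu, Matrix.one_mul, Matrix.mul_one]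
      _ = _ := by simp only [Matrix.mul_assoc]
  have hπ := Real.pi_pos
  intro i
  simp only [tailPhases]
  split_ifs with hi
  · refine phase_le_phase finProdFinEquiv S T (bcirc E) R hT.1 hEdet _ _
      (antitone_phase hA.1) (antitone_phase hB.1) ?_ ?_ ?_ _ r hrank (fun x hx => ?_) i hi
    · linarith [hA.phase_nonneg ⊤, hA.phase_lt_pi ⊥]
    · linarith [hB.phase_nonneg ⊤, hB.phase_lt_pi ⊥]
    · linarith [hB.phase_nonneg ⊤, hA.phase_lt_pi ⊥]
    · rw [← hS.bcirc_eq, ← hT.bcirc_eq]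
      obtain ⟨h1, h2⟩ := hR.mulVec_eq (x := x) fun k hk => hx k (by simpa using hk)
      rw [hAB]
      simp only [hForm, ← mulVec_mulVec, dotProduct_mulVec]
      rw [show star x ᵥ* bcirc E = star (bcirc E *ᵥ x) by
        rw [h1, ← h2, star_mulVec, conjTranspose_conjTranspose]]
  · exact hB.phase_nonneg i

end Approximation

end TPhase
end

open TPhase
theorem mainTheorem2 {n p : ℕ} [NeZero n] [NeZero p]
    (Ψ : (Fin (p * n) → ℝ) → ℝ) (hΨ : IsSymmetricGauge Ψ)
    (A : Tensor n n p) (hA : InSectorIco A 0 Real.pi)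
    (r : ℕ) (hr : r ≤ p * n) :
    (halfTruncations A r).Nonempty ∧
    (∀ E ∈ halfTruncations A r,
      E ∈ feasible A r ∧ phaseGauge Ψ (invSandwich E A) = Ψ (tailPhases A r)) ∧
    IsLeast {v : ℝ | ∃ E ∈ feasible A r, v = phaseGauge Ψ (invSandwich E A)}
      (Ψ (tailPhases A r)) := by
  have hne : (halfTruncations A r).Nonempty := by
    obtain ⟨T, φ, hφ, hT, hcirc⟩ := exists_canonical A hA.1
    obtain ⟨E, hE⟩ := hcirc (halfPhaseDiag A r)
    rw [← hφ.phase_eq] at hT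
    exact ⟨E, T, hT, hE⟩
  have hval : ∀ E ∈ halfTruncations A r,
      E ∈ feasible A r ∧ phaseGauge Ψ (invSandwich E A) = Ψ (tailPhases A r) := fun E hE =>
    ⟨mem_feasible_of_mem_halfTruncations hA hr hE,
      by rw [phaseGauge, (isCanonicalPhaseVector_tailPhases hA hr hE).phase_eq]⟩
  refine ⟨hne, hval, ?_, ?_⟩
  · obtain ⟨E, hE⟩ := hne
    exact ⟨E, (hval E hE).1, (hval E hE).2.symm⟩
  · rintro _ ⟨E, hE, rfl⟩
    exact hΨ.mono (tailPhases_nonneg hA r) (tailPhases_le_phase hA hE)
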